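/- Let $p$ be an odd prime and let $\mathbb{F}_q$ be a finite field of characteristic $p$. For $e\in\mathbb{F}_q^\ast$ let $D_e$ denote the smooth projective curve over $\mathbb{F}_q$ given by the affine equation $$Y^p-Y=eX^2 .$$ For $e_1,e_2\in\mathbb{F}_q^\ast$, the curves $D_{e_1}$ and $D_{e_2}$ are isomorphic over $\mathbb{F}_q$ if and only if $e_1/e_2$ is the product of a square in $\mathbb{F}_q^\ast$ with an element of $\mathbb{F}_p^\ast$. In particular, over an algebraic closure $\overline{\mathbb{F}}_q$ of $\mathbb{F}_q$ any two of these curves become isomorphic, i.e. $D_{e_1}\times_{\mathbb{F}_q}\overline{\mathbb{F}}_q\cong D_{e_2}\times_{\mathbb{F}_q}\overline{\mathbb{F}}_q$ over $\overline{\mathbb{F}}_q$ for all $e_1,e_2\in\mathbb{F}_q^\ast$. -/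

import Mathlib

open CategoryTheory CategoryTheory.Limits AlgebraicGeometry

universe u

noncomputable section

namespace ArtinSchreierCurve

variable {R : Type u} [CommRing R]

/-- The polynomial `Y ^ p - Y - e X ^ 2`, with `X = X 0` and `Y = X 1`. -/
def affinePoly (p : ℕ) (e : R) : MvPolynomial (Fin 2) R :=
  MvPolynomial.X 1 ^ p - MvPolynomial.X 1 - MvPolynomial.C e * MvPolynomial.X 0 ^ 2

/-- The polynomial `V - V ^ p - e U ^ 2`, with `U = X 0` and `V = X 1`: the equation
`Y ^ p - Y = e X ^ 2` in the coordinates `U = X / Y ^ ((p + 1) / 2)`, `V = 1 / Y` at infinity. -/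
def infinityPoly (p : ℕ) (e : R) : MvPolynomial (Fin 2) R :=
  MvPolynomial.X 1 - MvPolynomial.X 1 ^ p - MvPolynomial.C e * MvPolynomial.X 0 ^ 2

/-- The coordinate ring `R[X, Y] / (Y ^ p - Y - e X ^ 2)` of the affine curve. -/
abbrev AffineRing (p : ℕ) (e : R) : Type u :=
  MvPolynomial (Fin 2) R ⧸ Ideal.span {affinePoly p e}

/-- The coordinate ring `R[U, V] / (V - V ^ p - e U ^ 2)` of the chart at infinity. -/
abbrev InfinityRing (p : ℕ) (e : R) : Type u :=
  MvPolynomial (Fin 2) R ⧸ Ideal.span {infinityPoly p e}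

/-- The coordinate `X` on the affine curve. -/
def x (p : ℕ) (e : R) : AffineRing p e := Ideal.Quotient.mk _ (MvPolynomial.X 0)

/-- The coordinate `Y` on the affine curve. -/
def y (p : ℕ) (e : R) : AffineRing p e := Ideal.Quotient.mk _ (MvPolynomial.X 1)

/-- The coordinate `U` on the chart at infinity. -/
def u (p : ℕ) (e : R) : InfinityRing p e := Ideal.Quotient.mk _ (MvPolynomial.X 0)

/-- The coordinate `V` on the chart at infinity. -/
def v (p : ℕ) (e : R) : InfinityRing p e := Ideal.Quotient.mk _ (MvPolynomial.X 1)

theorem x_y_eq (p : ℕ) (e : R) :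
    y p e ^ p - y p e - algebraMap R _ e * x p e ^ 2 = 0 := by
  have h : Ideal.Quotient.mk (Ideal.span {affinePoly p e}) (affinePoly p e) = 0 :=
    Ideal.Quotient.eq_zero_iff_mem.2 (Ideal.subset_span rfl)
  exact h

theorem u_v_eq (p : ℕ) (e : R) :
    v p e - v p e ^ p - algebraMap R _ e * u p e ^ 2 = 0 := by
  have h : Ideal.Quotient.mk (Ideal.span {infinityPoly p e}) (infinityPoly p e) = 0 :=
    Ideal.Quotient.eq_zero_iff_mem.2 (Ideal.subset_span rfl)
  exact h

/-- The algebra map from the affine coordinate ring given by a point `(a, b)` of the curve. -/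
def affineLift (p : ℕ) (e : R) {S : Type*} [CommRing S] [Algebra R S] (a b : S)
    (h : b ^ p - b - algebraMap R S e * a ^ 2 = 0) : AffineRing p e →ₐ[R] S :=
  Ideal.Quotient.liftₐ _ (MvPolynomial.aeval ![a, b]) (by
    intro f hf
    have : Ideal.span {affinePoly p e} ≤ RingHom.ker (MvPolynomial.aeval (R := R) ![a, b]) := by
      rw [Ideal.span_le, Set.singleton_subset_iff]
      simpa [affinePoly, RingHom.mem_ker] using h
    exact this hf)

/-- The algebra map from the coordinate ring at infinity given by a point `(a, b)`. -/
def infinityLift (p : ℕ) (e : R) {S : Type*} [CommRing S] [Algebra R S] (a b : S)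
    (h : b - b ^ p - algebraMap R S e * a ^ 2 = 0) : InfinityRing p e →ₐ[R] S :=
  Ideal.Quotient.liftₐ _ (MvPolynomial.aeval ![a, b]) (by
    intro f hf
    have : Ideal.span {infinityPoly p e} ≤ RingHom.ker (MvPolynomial.aeval (R := R) ![a, b]) := by
      rw [Ideal.span_le, Set.singleton_subset_iff]
      simpa [infinityPoly, RingHom.mem_ker] using h
    exact this hf)

theorem affineLift_x (p : ℕ) (e : R) {S : Type*} [CommRing S] [Algebra R S] (a b : S)
    (h : b ^ p - b - algebraMap R S e * a ^ 2 = 0) : affineLift p e a b h (x p e) = a := by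
  change MvPolynomial.aeval ![a, b] (MvPolynomial.X 0) = a
  simp

theorem affineLift_y (p : ℕ) (e : R) {S : Type*} [CommRing S] [Algebra R S] (a b : S)
    (h : b ^ p - b - algebraMap R S e * a ^ 2 = 0) : affineLift p e a b h (y p e) = b := by
  change MvPolynomial.aeval ![a, b] (MvPolynomial.X 1) = b
  simp

theorem infinityLift_u (p : ℕ) (e : R) {S : Type*} [CommRing S] [Algebra R S] (a b : S)
    (h : b - b ^ p - algebraMap R S e * a ^ 2 = 0) : infinityLift p e a b h (u p e) = a := by
  change MvPolynomial.aeval ![a, b] (MvPolynomial.X 0) = a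
  simp

theorem infinityLift_v (p : ℕ) (e : R) {S : Type*} [CommRing S] [Algebra R S] (a b : S)
    (h : b - b ^ p - algebraMap R S e * a ^ 2 = 0) : infinityLift p e a b h (v p e) = b := by
  change MvPolynomial.aeval ![a, b] (MvPolynomial.X 1) = b
  simp

/-- The coordinate ring of the locus `Y ≠ 0` of the affine curve. -/
abbrev AffineOverlap (p : ℕ) (e : R) : Type u := Localization.Away (y p e)

/-- The coordinate ring of the locus `V ≠ 0` of the chart at infinity. -/
abbrev InfinityOverlap (p : ℕ) (e : R) : Type u := Localization.Away (v p e)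

/-- `Y⁻¹` on the locus `Y ≠ 0`. -/
def yInv (p : ℕ) (e : R) : AffineOverlap p e := IsLocalization.Away.invSelf (y p e)

/-- `V⁻¹` on the locus `V ≠ 0`. -/
def vInv (p : ℕ) (e : R) : InfinityOverlap p e := IsLocalization.Away.invSelf (v p e)

theorem y_mul_yInv (p : ℕ) (e : R) :
    algebraMap (AffineRing p e) (AffineOverlap p e) (y p e) * yInv p e = 1 :=
  IsLocalization.Away.mul_invSelf _

theorem v_mul_vInv (p : ℕ) (e : R) :
    algebraMap (InfinityRing p e) (InfinityOverlap p e) (v p e) * vInv p e = 1 :=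
  IsLocalization.Away.mul_invSelf _

/-- The change of coordinates turns one equation into the other. -/
theorem change_coordinates {S : Type*} [CommRing S] {p : ℕ} (hp : Odd p) {a b c : S} (f : S)
    (hbc : b * c = 1) :
    (b ^ p - b - f * a ^ 2 = 0 → c - c ^ p - f * (a * c ^ ((p + 1) / 2)) ^ 2 = 0) ∧
    (b - b ^ p - f * a ^ 2 = 0 → c ^ p - c - f * (a * c ^ ((p + 1) / 2)) ^ 2 = 0) := by
  obtain ⟨m, rfl⟩ := hp
  have hm : (2 * m + 1 + 1) / 2 = m + 1 := by omega
  rw [hm]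
  have h1 : b ^ (2 * m + 1) * c ^ (2 * m + 2) = c := by
    rw [pow_succ c (2 * m + 1), ← mul_assoc, ← mul_pow, hbc, one_pow, one_mul]
  have h2 : b * c ^ (2 * m + 2) = c ^ (2 * m + 1) := by
    rw [pow_succ' c (2 * m + 1), ← mul_assoc, hbc, one_mul]
  constructor <;> intro h
  · calc _ = (b ^ (2 * m + 1) - b - f * a ^ 2) * c ^ (2 * m + 2) := by
          rw [sub_mul, sub_mul, h1, h2]; ring
      _ = 0 := by rw [h, zero_mul]
  · calc _ = (b - b ^ (2 * m + 1) - f * a ^ 2) * c ^ (2 * m + 2) := by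
          rw [sub_mul, sub_mul, h1, h2]; ring
      _ = 0 := by rw [h, zero_mul]

/-- The map of coordinate rings `U ↦ X / Y ^ ((p + 1) / 2)`, `V ↦ 1 / Y`. -/
def infinityToAffineOverlap (p : ℕ) (hp : Odd p) (e : R) :
    InfinityRing p e →ₐ[R] AffineOverlap p e :=
  infinityLift p e (algebraMap _ _ (x p e) * yInv p e ^ ((p + 1) / 2)) (yInv p e)
    ((change_coordinates hp _ (y_mul_yInv p e)).1 (by
      simpa [← IsScalarTower.algebraMap_apply] using
        congrArg (algebraMap (AffineRing p e) (AffineOverlap p e)) (x_y_eq p e)))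

/-- The map of coordinate rings `X ↦ U / V ^ ((p + 1) / 2)`, `Y ↦ 1 / V`. -/
def affineToInfinityOverlap (p : ℕ) (hp : Odd p) (e : R) :
    AffineRing p e →ₐ[R] InfinityOverlap p e :=
  affineLift p e (algebraMap _ _ (u p e) * vInv p e ^ ((p + 1) / 2)) (vInv p e)
    ((change_coordinates hp _ (v_mul_vInv p e)).2 (by
      simpa [← IsScalarTower.algebraMap_apply] using
        congrArg (algebraMap (InfinityRing p e) (InfinityOverlap p e)) (u_v_eq p e)))

theorem infinityToAffineOverlap_isUnit (p : ℕ) (hp : Odd p) (e : R)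
    (z : Submonoid.powers (v p e)) : IsUnit (infinityToAffineOverlap p hp e z) := by
  obtain ⟨_, n, rfl⟩ := z
  rw [map_pow]
  refine IsUnit.pow n ?_
  rw [infinityToAffineOverlap, infinityLift_v]
  exact IsUnit.of_mul_eq_one_right _ (y_mul_yInv p e)

theorem affineToInfinityOverlap_isUnit (p : ℕ) (hp : Odd p) (e : R)
    (z : Submonoid.powers (y p e)) : IsUnit (affineToInfinityOverlap p hp e z) := by
  obtain ⟨_, n, rfl⟩ := z
  rw [map_pow]
  refine IsUnit.pow n ?_
  rw [affineToInfinityOverlap, affineLift_y]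
  exact IsUnit.of_mul_eq_one_right _ (v_mul_vInv p e)

/-- The extension of `infinityToAffineOverlap` to the locus `V ≠ 0`. -/
def overlapHom (p : ℕ) (hp : Odd p) (e : R) : InfinityOverlap p e →ₐ[R] AffineOverlap p e :=
  IsLocalization.liftAlgHom (M := Submonoid.powers (v p e))
    (infinityToAffineOverlap_isUnit p hp e)

/-- The extension of `affineToInfinityOverlap` to the locus `Y ≠ 0`. -/
def overlapInv (p : ℕ) (hp : Odd p) (e : R) : AffineOverlap p e →ₐ[R] InfinityOverlap p e :=
  IsLocalization.liftAlgHom (M := Submonoid.powers (y p e))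
    (affineToInfinityOverlap_isUnit p hp e)

theorem overlapHom_algebraMap (p : ℕ) (hp : Odd p) (e : R) (a : InfinityRing p e) :
    overlapHom p hp e (algebraMap _ _ a) = infinityToAffineOverlap p hp e a :=
  IsLocalization.lift_eq _ a

theorem overlapInv_algebraMap (p : ℕ) (hp : Odd p) (e : R) (a : AffineRing p e) :
    overlapInv p hp e (algebraMap _ _ a) = affineToInfinityOverlap p hp e a :=
  IsLocalization.lift_eq _ a

theorem overlapHom_vInv (p : ℕ) (hp : Odd p) (e : R) :
    overlapHom p hp e (vInv p e) = algebraMap _ _ (y p e) := by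
  have h := congrArg (overlapHom p hp e) (v_mul_vInv p e)
  rw [map_mul, overlapHom_algebraMap, infinityToAffineOverlap, infinityLift_v, map_one] at h
  have h' := y_mul_yInv p e
  calc _ = algebraMap (AffineRing p e) (AffineOverlap p e) (y p e) * yInv p e *
        overlapHom p hp e (vInv p e) := by rw [h', one_mul]
    _ = _ := by rw [mul_assoc, h, mul_one]

theorem overlapInv_yInv (p : ℕ) (hp : Odd p) (e : R) :
    overlapInv p hp e (yInv p e) = algebraMap _ _ (v p e) := by
  have h := congrArg (overlapInv p hp e) (y_mul_yInv p e)
  rw [map_mul, overlapInv_algebraMap, affineToInfinityOverlap, affineLift_y, map_one] at h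
  have h' := v_mul_vInv p e
  calc _ = algebraMap (InfinityRing p e) (InfinityOverlap p e) (v p e) * vInv p e *
        overlapInv p hp e (yInv p e) := by rw [h', one_mul]
    _ = _ := by rw [mul_assoc, h, mul_one]

theorem affineRing_hom_ext {p : ℕ} {e : R} {S : Type*} [CommRing S] [Algebra R S]
    {f g : AffineRing p e →ₐ[R] S} (hx : f (x p e) = g (x p e)) (hy : f (y p e) = g (y p e)) :
    f = g := by
  apply Ideal.Quotient.algHom_ext
  apply MvPolynomial.algHom_ext
  intro i
  fin_cases i
  · exact hx
  · exact hy

theorem infinityRing_hom_ext {p : ℕ} {e : R} {S : Type*} [CommRing S] [Algebra R S]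
    {f g : InfinityRing p e →ₐ[R] S} (hu : f (u p e) = g (u p e)) (hv : f (v p e) = g (v p e)) :
    f = g := by
  apply Ideal.Quotient.algHom_ext
  apply MvPolynomial.algHom_ext
  intro i
  fin_cases i
  · exact hu
  · exact hv

theorem overlapInv_comp_overlapHom (p : ℕ) (hp : Odd p) (e : R) :
    (overlapInv p hp e).comp (overlapHom p hp e) = AlgHom.id R _ := by
  apply IsLocalization.algHom_ext (Submonoid.powers (v p e))
  apply infinityRing_hom_ext
  · change overlapInv p hp e (overlapHom p hp e (algebraMap _ _ (u p e))) = algebraMap _ _ (u p e)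
    rw [overlapHom_algebraMap, infinityToAffineOverlap, infinityLift_u, map_mul, map_pow,
      overlapInv_yInv, overlapInv_algebraMap, affineToInfinityOverlap, affineLift_x, mul_assoc,
      ← mul_pow, mul_comm (vInv p e), v_mul_vInv, one_pow, mul_one]
  · change overlapInv p hp e (overlapHom p hp e (algebraMap _ _ (v p e))) = algebraMap _ _ (v p e)
    rw [overlapHom_algebraMap, infinityToAffineOverlap, infinityLift_v, overlapInv_yInv]

theorem overlapHom_comp_overlapInv (p : ℕ) (hp : Odd p) (e : R) :
    (overlapHom p hp e).comp (overlapInv p hp e) = AlgHom.id R _ := by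
  apply IsLocalization.algHom_ext (Submonoid.powers (y p e))
  apply affineRing_hom_ext
  · change overlapHom p hp e (overlapInv p hp e (algebraMap _ _ (x p e))) = algebraMap _ _ (x p e)
    rw [overlapInv_algebraMap, affineToInfinityOverlap, affineLift_x, map_mul, map_pow,
      overlapHom_vInv, overlapHom_algebraMap, infinityToAffineOverlap, infinityLift_u, mul_assoc,
      ← mul_pow, mul_comm (yInv p e), y_mul_yInv, one_pow, mul_one]
  · change overlapHom p hp e (overlapInv p hp e (algebraMap _ _ (y p e))) = algebraMap _ _ (y p e)
    rw [overlapInv_algebraMap, affineToInfinityOverlap, affineLift_y, overlapHom_vInv]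

/-- The identification of the locus `V ≠ 0` at infinity with the locus `Y ≠ 0` of the affine
curve. -/
def overlapEquiv (p : ℕ) (hp : Odd p) (e : R) : InfinityOverlap p e ≃ₐ[R] AffineOverlap p e :=
  AlgEquiv.ofAlgHom (overlapHom p hp e) (overlapInv p hp e)
    (overlapHom_comp_overlapInv p hp e) (overlapInv_comp_overlapHom p hp e)

/-- The affine curve `Y ^ p - Y = e X ^ 2`. -/
abbrev affineChart (p : ℕ) (e : R) : Scheme.{u} := Spec (.of (AffineRing p e))

/-- The affine curve `V - V ^ p = e U ^ 2`, which contains the point at infinity `U = V = 0`. -/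
abbrev infinityChart (p : ℕ) (e : R) : Scheme.{u} := Spec (.of (InfinityRing p e))

/-- The common open part of the two charts, the locus `Y ≠ 0`. -/
abbrev overlap (p : ℕ) (e : R) : Scheme.{u} := Spec (.of (AffineOverlap p e))

/-- The inclusion of the overlap in the affine curve. -/
def overlapToAffine (p : ℕ) (e : R) : overlap p e ⟶ affineChart p e :=
  Spec.map (CommRingCat.ofHom (algebraMap (AffineRing p e) (AffineOverlap p e)))

/-- The inclusion of the overlap in the chart at infinity,
`(X, Y) ↦ (U, V) = (X / Y ^ ((p + 1) / 2), 1 / Y)`. -/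
def overlapToInfinity (p : ℕ) (hp : Odd p) (e : R) : overlap p e ⟶ infinityChart p e :=
  Spec.map (CommRingCat.ofHom (infinityToAffineOverlap p hp e).toRingHom)

instance isOpenImmersion_overlapToAffine (p : ℕ) (e : R) :
    IsOpenImmersion (overlapToAffine p e) :=
  IsOpenImmersion.of_isLocalization (y p e)

instance isOpenImmersion_overlapToInfinity (p : ℕ) (hp : Odd p) (e : R) :
    IsOpenImmersion (overlapToInfinity p hp e) := by
  have h : overlapToInfinity p hp e =
      Spec.map (overlapEquiv p hp e).toRingEquiv.toCommRingCatIso.hom ≫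
        Spec.map (CommRingCat.ofHom
          (algebraMap (InfinityRing p e) (InfinityOverlap p e))) := by
    rw [← Spec.map_comp]
    refine congrArg Spec.map (CommRingCat.hom_ext (RingHom.ext fun a => ?_))
    exact (overlapHom_algebraMap p hp e a).symm
  have : IsOpenImmersion (Spec.map (CommRingCat.ofHom
      (algebraMap (InfinityRing p e) (InfinityOverlap p e)))) :=
    IsOpenImmersion.of_isLocalization (v p e)
  rw [h]
  infer_instance

/-- Two schemes can be glued along a common open subscheme. -/
instance hasPushout_of_isOpenImmersion {U X Y : Scheme.{u}} (f : U ⟶ X) (g : U ⟶ Y)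
    [IsOpenImmersion f] [IsOpenImmersion g] : HasPushout f g := by
  have h : ∀ {i j : WalkingSpan} (a : i ⟶ j), IsOpenImmersion ((span f g).map a) := by
    rintro i j (_ | (_ | _))
    · rw [WidePushoutShape.hom_id, CategoryTheory.Functor.map_id]
      infer_instance
    · change IsOpenImmersion f
      infer_instance
    · change IsOpenImmersion g
      infer_instance
  have hm : ∀ i, Mono ((span f g ⋙ Scheme.forget).map (WidePushoutShape.Hom.init i)) := by
    intro i
    have := h (WidePushoutShape.Hom.init i)
    rw [mono_iff_injective]
    exact ((span f g).map (WidePushoutShape.Hom.init i)).isOpenEmbedding.injective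
  have hd : (span f g ⋙ Scheme.forget).IsLocallyDirected := inferInstance
  exact inferInstanceAs (HasColimit (span f g))

/-- The structure morphism of the affine curve. -/
def affineStructure (p : ℕ) (e : R) : affineChart p e ⟶ Spec (.of R) :=
  Spec.map (CommRingCat.ofHom (algebraMap R (AffineRing p e)))

/-- The structure morphism of the chart at infinity. -/
def infinityStructure (p : ℕ) (e : R) : infinityChart p e ⟶ Spec (.of R) :=
  Spec.map (CommRingCat.ofHom (algebraMap R (InfinityRing p e)))

theorem structure_compat (p : ℕ) (hp : Odd p) (e : R) :
    overlapToAffine p e ≫ affineStructure p e =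
      overlapToInfinity p hp e ≫ infinityStructure p e := by
  rw [overlapToAffine, affineStructure, overlapToInfinity, infinityStructure,
    ← Spec.map_comp, ← Spec.map_comp]
  refine congrArg Spec.map (CommRingCat.hom_ext (RingHom.ext fun r => ?_))
  exact ((infinityToAffineOverlap p hp e).commutes r).symm

end ArtinSchreierCurve

open ArtinSchreierCurve in
/-- The curve `D_e` over `R` given by the affine equation `Y ^ p - Y = e X ^ 2` (`p` odd), as a
scheme over `Spec R`. It is the gluing of the affine curve `Y ^ p - Y = e X ^ 2` and the affine
curve `V - V ^ p = e U ^ 2` along `Y ≠ 0` and `V ≠ 0`, by `U = X / Y ^ ((p + 1) / 2)` and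
`V = 1 / Y`. Over a field of characteristic `p`, both charts are smooth, since the derivative of
`Y ^ p - Y` is `-1`; if moreover `e ≠ 0`, then `(1 : Y) = (V : 1)` makes the curve a double cover
of the projective line, finite and geometrically integral, so that `D_e` is the smooth projective
model of the affine curve. -/
def artinSchreierCurve {R : Type u} [CommRing R] (p : ℕ) (hp : Odd p) (e : R) :
    Over (Spec (.of R)) :=
  Over.mk (Y := pushout (overlapToAffine p e) (overlapToInfinity p hp e))
    (pushout.desc (affineStructure p e) (infinityStructure p e) (structure_compat p hp e))

/-- The base change of a scheme over `Spec K` to `Spec L`. -/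
def schemeBaseChange {K : Type u} (L : Type u) [CommRing K] [CommRing L] [Algebra K L]
    (D : Over (Spec (.of K))) : Over (Spec (.of L)) :=
  (Over.pullback (Spec.map (CommRingCat.ofHom (algebraMap K L)))).obj D

end

/-! Sufficiency. If `c` lies in `𝔽_p^*`, the substitution `X ↦ a X`, `Y ↦ c Y` multiplies `Y ^ p -
Y` by `c` and turns the equation with coefficient `e` into the one with coefficient `c⁻¹ * e * a ^
2`. It extends over the point at infinity. The scaling is set up over a ring map `R → S`, where it
gives a cartesian square of curves (`isPullback_twist`). For `R = S` this is the isomorphism sought;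
for `S` algebraically closed, `a` can be chosen with `e * a ^ 2 = 1`, so every `D_e` becomes `D_1`.

Necessity. Isomorphic curves over `F`, with `q` elements, have equally many rational points, and
each has exactly one point at infinity (`natCard_sections`), so the affine equations have equally
many solutions. Suppose that `e₁ / e₂` is not a square. The quadratic character sums then cancel,
the two counts add up to `2 * q`, and each is `q`. If `𝔽_p` contains a nonsquare of `F`, dividing by
it makes `e₁ / e₂` a square, as claimed. Otherwise a generator of `𝔽_p^*` has a square root `s` in
`F`, of order `2 * (p - 1)`. Its powers act freely on the solutions with `X ≠ 0` by `(g X, g ^ 2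
Y)`, and `p` solutions have `X = 0`, so `q ≡ p` modulo `2 * (p - 1)`. But `q ≡ 1` by Lagrange in
`F^*`, so `2 * (p - 1)` divides `p - 1`, which is absurd. -/

/-! ### Schemes glued from two open pieces, and cartesian morphisms between them. -/

section Gluing

variable {U X Y : Scheme.{u}} (f : U ⟶ X) (g : U ⟶ Y) [IsOpenImmersion f] [IsOpenImmersion g]

theorem AlgebraicGeometry.isOpenImmersion_span_map {i j : WalkingSpan} (a : i ⟶ j) :
    IsOpenImmersion ((span f g).map a) := by
  obtain _ | _ | _ := a
  · rw [WidePushoutShape.hom_id, CategoryTheory.Functor.map_id]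
    infer_instance
  · exact inferInstanceAs (IsOpenImmersion f)
  · exact inferInstanceAs (IsOpenImmersion g)

theorem AlgebraicGeometry.isLocallyDirected_span :
    (span f g ⋙ Scheme.forget).IsLocallyDirected := by
  have h := @isOpenImmersion_span_map _ _ _ f g _ _
  have : ∀ i, Mono ((span f g ⋙ Scheme.forget).map (WidePushoutShape.Hom.init i)) := by
    intro i
    have := h (WidePushoutShape.Hom.init i)
    rw [mono_iff_injective]
    exact ((span f g).map (WidePushoutShape.Hom.init i)).isOpenEmbedding.injective
  infer_instance

instance AlgebraicGeometry.isOpenImmersion_pushout_inl :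
    IsOpenImmersion (pushout.inl f g) := by
  have h := @isOpenImmersion_span_map _ _ _ f g _ _
  have := isLocallyDirected_span f g
  exact inferInstanceAs (IsOpenImmersion (colimit.ι (span f g) WalkingSpan.left))

instance AlgebraicGeometry.isOpenImmersion_pushout_inr :
    IsOpenImmersion (pushout.inr f g) := by
  have h := @isOpenImmersion_span_map _ _ _ f g _ _
  have := isLocallyDirected_span f g
  exact inferInstanceAs (IsOpenImmersion (colimit.ι (span f g) WalkingSpan.right))

theorem AlgebraicGeometry.exists_of_pushout_inl_eq_inr {x : X} {y : Y}
    (hxy : pushout.inl f g x = pushout.inr f g y) : ∃ z, f z = x ∧ g z = y := by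
  have h := @isOpenImmersion_span_map _ _ _ f g _ _
  have := isLocallyDirected_span f g
  obtain ⟨k, fi, fj, z, hx, hy⟩ := (Scheme.IsLocallyDirected.ι_eq_ι_iff (span f g)
    (i := WalkingSpan.left) (j := WalkingSpan.right)).1 hxy
  -- The common source is either the left piece itself, which has no arrow to the right one, or the
  -- overlap.
  obtain _ | _ := fi
  · exact nomatch (show WidePushoutShape.Hom (some WalkingPair.left) (some .right) from fj)
  · obtain rfl := Subsingleton.elim fj WalkingSpan.Hom.snd
    exact ⟨z, hx, hy⟩

theorem AlgebraicGeometry.pushout_inl_or_inr (w : ↥(pushout f g)) :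
    (∃ x, pushout.inl f g x = w) ∨ ∃ y, pushout.inr f g y = w := by
  have h := @isOpenImmersion_span_map _ _ _ f g _ _
  have := isLocallyDirected_span f g
  obtain ⟨i, z, hz⟩ := Scheme.IsLocallyDirected.ι_jointly_surjective (span f g) w
  obtain _ | _ | _ := i
  · refine .inl ⟨f z, ?_⟩
    rw [← hz]
    exact congrArg (fun φ : U ⟶ pushout f g => φ z) (colimit.w (span f g) WalkingSpan.Hom.fst)
  · exact .inl ⟨z, hz⟩
  · exact .inr ⟨z, hz⟩

/-- The open cover of a scheme glued from two open pieces by these pieces. -/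
noncomputable def AlgebraicGeometry.pushoutOpenCover : (pushout f g).OpenCover :=
  .mkOfCovers Bool (fun b => b.rec X Y)
    (fun b => b.rec (pushout.inl f g) (pushout.inr f g))
    (fun w => by
      obtain ⟨x, hx⟩ | ⟨y, hy⟩ := pushout_inl_or_inr f g w
      · exact ⟨false, x, hx⟩
      · exact ⟨true, y, hy⟩)
    (fun b => by cases b <;> dsimp only <;> infer_instance)

variable {U' X' Y' : Scheme.{u}} (f' : U' ⟶ X') (g' : U' ⟶ Y')
  [IsOpenImmersion f'] [IsOpenImmersion g']

/-- The preimage of the left piece under a morphism of glued schemes, if the overlap in the right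
piece is the preimage of the overlap. -/
theorem AlgebraicGeometry.isPullback_pushout_inl (c : U' ⟶ U) (a : X' ⟶ X) (b : Y' ⟶ Y)
    (ha : f' ≫ a = c ≫ f) (hb : g' ≫ b = c ≫ g)
    (hY : ∀ y, b y ∈ Set.range g → y ∈ Set.range g') :
    IsPullback a (pushout.inl f' g') (pushout.inl f g) (pushout.map f' g' f g a b c ha hb) := by
  -- Both vertical maps are open immersions, so it suffices that the range of one is the preimage of
  -- the range of the other.
  refine IsOpenImmersion.isPullback _ _ _ _ (pushout.inl_desc _ _ _) ?_
  ext w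
  constructor
  · rintro ⟨x, hx⟩
    obtain ⟨x', rfl⟩ | ⟨y, rfl⟩ := pushout_inl_or_inr f' g' w
    · exact ⟨x', rfl⟩
    · rw [← Scheme.Hom.comp_apply, pushout.inr_desc, Scheme.Hom.comp_apply] at hx
      -- The image of `y` lies in both pieces, hence in the overlap; `hY` then puts `y` in the
      -- overlap `U'`.
      obtain ⟨z, -, hz⟩ := exists_of_pushout_inl_eq_inr f g hx
      obtain ⟨z', rfl⟩ := hY y ⟨z, hz⟩
      refine ⟨f' z', ?_⟩
      rw [← Scheme.Hom.comp_apply, ← Scheme.Hom.comp_apply, pushout.condition]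
  · rintro ⟨x, rfl⟩
    refine ⟨a x, ?_⟩
    rw [← Scheme.Hom.comp_apply, ← Scheme.Hom.comp_apply, pushout.inl_desc]

/-- The preimage of the right piece under a morphism of glued schemes, if the overlap in the left
piece is the preimage of the overlap. -/
theorem AlgebraicGeometry.isPullback_pushout_inr (c : U' ⟶ U) (a : X' ⟶ X) (b : Y' ⟶ Y)
    (ha : f' ≫ a = c ≫ f) (hb : g' ≫ b = c ≫ g)
    (hX : ∀ x, a x ∈ Set.range f → x ∈ Set.range f') :
    IsPullback b (pushout.inr f' g') (pushout.inr f g) (pushout.map f' g' f g a b c ha hb) := by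
  refine IsOpenImmersion.isPullback _ _ _ _ (pushout.inr_desc _ _ _) ?_
  ext w
  constructor
  · rintro ⟨y, hy⟩
    obtain ⟨x, rfl⟩ | ⟨y', rfl⟩ := pushout_inl_or_inr f' g' w
    · rw [← Scheme.Hom.comp_apply, pushout.inl_desc, Scheme.Hom.comp_apply] at hy
      obtain ⟨z, hz, -⟩ := exists_of_pushout_inl_eq_inr f g hy.symm
      obtain ⟨z', rfl⟩ := hX x ⟨z, hz⟩
      refine ⟨g' z', ?_⟩
      rw [← Scheme.Hom.comp_apply, ← Scheme.Hom.comp_apply, pushout.condition]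
    · exact ⟨y', rfl⟩
  · rintro ⟨y, rfl⟩
    refine ⟨b y, ?_⟩
    rw [← Scheme.Hom.comp_apply, ← Scheme.Hom.comp_apply, pushout.inr_desc]

/-- A cartesian square may be restricted to an open piece of its upper right corner. -/
theorem AlgebraicGeometry.isPullback_pullbackHom_of_isPullback {W X Y Z V V' : Scheme.{u}}
    {p : W ⟶ X} {q : W ⟶ Y} {r : X ⟶ Z} {s : Y ⟶ Z} {i : V ⟶ X} {i' : V' ⟶ W} {p' : V' ⟶ V}
    (h : IsPullback p' i' i p) (H : IsPullback p' (i' ≫ q) (i ≫ r) s) :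
    IsPullback (pullback.snd p i) (pullback.fst p i ≫ q) (i ≫ r) s := by
  refine H.of_iso h.flip.isoPullback (.refl _) (.refl _) (.refl _) ?_ ?_ ?_ ?_ <;> simp

/-- A morphism of glued schemes is cartesian over a morphism of bases if it is so on the pieces. -/
theorem AlgebraicGeometry.isPullback_pushout_map (c : U' ⟶ U) (a : X' ⟶ X) (b : Y' ⟶ Y)
    (ha : f' ≫ a = c ≫ f) (hb : g' ≫ b = c ≫ g)
    (hX : ∀ x, a x ∈ Set.range f → x ∈ Set.range f')
    (hY : ∀ y, b y ∈ Set.range g → y ∈ Set.range g')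
    {S S' : Scheme.{u}} (s : S' ⟶ S) (r : pushout f g ⟶ S) (r' : pushout f' g' ⟶ S')
    (hl : IsPullback a (pushout.inl f' g' ≫ r') (pushout.inl f g ≫ r) s)
    (hr : IsPullback b (pushout.inr f' g' ≫ r') (pushout.inr f g ≫ r) s) :
    IsPullback (pushout.map f' g' f g a b c ha hb) r' r s := by
  refine Scheme.isPullback_of_openCover _ _ _ _ (pushoutOpenCover f g) fun i => ?_
  cases i
  · exact isPullback_pullbackHom_of_isPullback
      (isPullback_pushout_inl f g f' g' c a b ha hb hY) hl
  · exact isPullback_pullbackHom_of_isPullback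
      (isPullback_pushout_inr f g f' g' c a b ha hb hX) hr

end Gluing

/-- A square of commutative rings with the universal property of a pushout is a pushout. -/
theorem CommRingCat.isPushout_of_existsUnique {A B C P : Type u} [CommRing A] [CommRing B]
    [CommRing C] [CommRing P] {f : A →+* B} {g : A →+* C} {i : B →+* P} {j : C →+* P}
    (w : i.comp f = j.comp g)
    (h : ∀ (T : Type u) [CommRing T] (α : B →+* T) (β : C →+* T), α.comp f = β.comp g →
      ∃! γ : P →+* T, γ.comp i = α ∧ γ.comp j = β) :
    IsPushout (CommRingCat.ofHom f) (CommRingCat.ofHom g) (CommRingCat.ofHom i)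
      (CommRingCat.ofHom j) := by
  refine ⟨⟨CommRingCat.hom_ext w⟩, ⟨PushoutCocone.IsColimit.mk _
    (fun s => CommRingCat.ofHom
      (h s.pt s.inl.hom s.inr.hom (congrArg CommRingCat.Hom.hom s.condition)).choose) ?_ ?_ ?_⟩⟩
  · intro s
    exact CommRingCat.hom_ext
      (h s.pt s.inl.hom s.inr.hom (congrArg CommRingCat.Hom.hom s.condition)).choose_spec.1.1
  · intro s
    exact CommRingCat.hom_ext
      (h s.pt s.inl.hom s.inr.hom (congrArg CommRingCat.Hom.hom s.condition)).choose_spec.1.2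
  · intro s m h₁ h₂
    exact CommRingCat.hom_ext
      ((h s.pt s.inl.hom s.inr.hom (congrArg CommRingCat.Hom.hom s.condition)).choose_spec.2
        m.hom ⟨congrArg CommRingCat.Hom.hom h₁, congrArg CommRingCat.Hom.hom h₂⟩)

/-! ### Scaling of coordinates on the two charts and on their overlap. -/

noncomputable section

namespace ArtinSchreierCurve

variable {R S : Type u} [CommRing R] [CommRing S] [Algebra R S] {p : ℕ} {e : R} {e' : S}

theorem affineRing_ringHom_ext {T : Type*} [CommRing T] {f g : AffineRing p e →+* T}
    (h : f.comp (algebraMap R _) = g.comp (algebraMap R _))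
    (hx : f (x p e) = g (x p e)) (hy : f (y p e) = g (y p e)) : f = g := by
  let := (f.comp (algebraMap R _)).toAlgebra
  let f' : AffineRing p e →ₐ[R] T := { f with commutes' := fun _ => rfl }
  let g' : AffineRing p e →ₐ[R] T := { g with commutes' := fun r => (RingHom.congr_fun h r).symm }
  have : f' = g' := affineRing_hom_ext hx hy
  exact RingHom.ext fun z => DFunLike.congr_fun this z

theorem infinityRing_ringHom_ext {T : Type*} [CommRing T] {f g : InfinityRing p e →+* T}
    (h : f.comp (algebraMap R _) = g.comp (algebraMap R _))
    (hu : f (u p e) = g (u p e)) (hv : f (v p e) = g (v p e)) : f = g := by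
  let := (f.comp (algebraMap R _)).toAlgebra
  let f' : InfinityRing p e →ₐ[R] T := { f with commutes' := fun _ => rfl }
  let g' : InfinityRing p e →ₐ[R] T :=
    { g with commutes' := fun r => (RingHom.congr_fun h r).symm }
  have : f' = g' := infinityRing_hom_ext hu hv
  exact RingHom.ext fun z => DFunLike.congr_fun this z

/-- Scaling `X` by `a` and `Y` by `c ∈ 𝔽_p` changes the coefficient `e` into `c⁻¹ * e * a ^ 2`. -/
structure IsTwist (p : ℕ) (e : R) (e' : S) (a c : Sˣ) : Prop where
  eq : algebraMap R S e * (a : S) ^ 2 = c * e'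
  pow : (c : S) ^ p = c

/-- These are the factors by which `U = X / Y ^ ((p + 1) / 2)` and `V = 1 / Y` get multiplied. Since
`c ^ p = c`, one has `e * a ^ 2 * c⁻¹ ^ (p + 1) = e' * c⁻¹ ^ p = c⁻¹ * e'`, the same kind of
relation. -/
theorem IsTwist.inv {a c : Sˣ} (h : IsTwist p e e' a c) (hp : Odd p) :
    IsTwist p e e' (a * c⁻¹ ^ ((p + 1) / 2)) c⁻¹ := by
  have hc : c ^ p = c := Units.ext h.pow
  refine ⟨?_, ?_⟩
  · have h2 : (p + 1) / 2 * 2 = p + 1 := by obtain ⟨m, rfl⟩ := hp; omega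
    have h3 : c⁻¹ ^ (p + 1) * c = c⁻¹ := by
      rw [pow_succ, inv_mul_cancel_right, inv_pow, hc]
    rw [← Units.val_pow_eq_pow_val, mul_pow, ← pow_mul, h2, Units.val_mul, ← mul_assoc,
      Units.val_pow_eq_pow_val, h.eq, mul_right_comm, ← Units.val_mul, mul_comm c, h3]
  · rw [← Units.val_pow_eq_pow_val, inv_pow, hc]

/-- The map of affine coordinate rings `X ↦ a X`, `Y ↦ c Y`. -/
def affineTwist {a c : Sˣ} (h : IsTwist p e e' a c) : AffineRing p e →ₐ[R] AffineRing p e' :=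
  affineLift p e (algebraMap S _ a * x p e') (algebraMap S _ c * y p e') (by
    have h1 := congrArg (algebraMap S (AffineRing p e')) h.eq
    have h2 := congrArg (algebraMap S (AffineRing p e')) h.pow
    have h3 := x_y_eq p e'
    rw [map_mul, map_mul, map_pow, ← IsScalarTower.algebraMap_apply] at h1
    rw [map_pow] at h2
    rw [mul_pow, mul_pow, h2, ← mul_assoc, h1]
    linear_combination (algebraMap S (AffineRing p e') c) * h3)

/-- The map of coordinate rings at infinity `U ↦ a U`, `V ↦ c V`. -/
def infinityTwist {a c : Sˣ} (h : IsTwist p e e' a c) :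
    InfinityRing p e →ₐ[R] InfinityRing p e' :=
  infinityLift p e (algebraMap S _ a * u p e') (algebraMap S _ c * v p e') (by
    have h1 := congrArg (algebraMap S (InfinityRing p e')) h.eq
    have h2 := congrArg (algebraMap S (InfinityRing p e')) h.pow
    have h3 := u_v_eq p e'
    rw [map_mul, map_mul, map_pow, ← IsScalarTower.algebraMap_apply] at h1
    rw [map_pow] at h2
    rw [mul_pow, mul_pow, h2, ← mul_assoc, h1]
    linear_combination (algebraMap S (InfinityRing p e') c) * h3)

/-- The scaled ring is the base change of the original one: as `a` and `c` are units, a compatible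
pair `α`, `β` forces the images `α a⁻¹ * β x` and `α c⁻¹ * β y` of the coordinates, and these solve
the equation with coefficient `e'`. -/
theorem isPushout_affineTwist {a c : Sˣ} (h : IsTwist p e e' a c) :
    IsPushout (CommRingCat.ofHom (algebraMap R S))
      (CommRingCat.ofHom (algebraMap R (AffineRing p e)))
      (CommRingCat.ofHom (algebraMap S (AffineRing p e')))
      (CommRingCat.ofHom (affineTwist h).toRingHom) := by
  refine CommRingCat.isPushout_of_existsUnique ?_ fun T _ α β hαβ => ?_
  · ext r
    exact ((affineTwist h).commutes r).symm
  let := α.toAlgebra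
  have hα : ∀ s, algebraMap S T s = α s := fun _ => rfl
  have hinv : ∀ s : Sˣ, α ↑s⁻¹ * α s = 1 := fun s => by rw [← map_mul, s.inv_mul, map_one]
  have hβ : ∀ r, α (algebraMap R S r) = β (algebraMap R _ r) := RingHom.congr_fun hαβ
  have key : (α ↑c⁻¹ * β (y p e)) ^ p - α ↑c⁻¹ * β (y p e) -
      algebraMap S T e' * (α ↑a⁻¹ * β (x p e)) ^ 2 = 0 := by
    have h1 := congrArg α h.eq
    have hc : c⁻¹ ^ p = c⁻¹ := by rw [inv_pow, show c ^ p = c from Units.ext h.pow]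
    have h2 : α ↑c⁻¹ ^ p = α ↑c⁻¹ := by
      rw [← map_pow, ← Units.val_pow_eq_pow_val, hc]
    have h3 := congrArg β (x_y_eq p e)
    simp only [map_sub, map_mul, map_pow, map_zero, hβ] at h1 h3
    rw [mul_pow, h2, hα]
    have h4 := hinv a
    have h5 := hinv c
    -- The equation `h3`, multiplied by `c⁻¹`, with `c⁻¹ * e` replaced by `e' * a⁻¹ ^ 2` through
    -- `h1`.
    linear_combination α ↑c⁻¹ * h3 + α ↑c⁻¹ * (α ↑a⁻¹ * β (x p e)) ^ 2 * h1 +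
      (α e' * (α ↑a⁻¹ * β (x p e)) ^ 2) * h5 -
      α ↑c⁻¹ * β (algebraMap R _ e) * β (x p e) ^ 2 * (α ↑a⁻¹ * α a + 1) * h4
  refine ⟨(affineLift p e' _ _ key).toRingHom, ⟨?_, ?_⟩, ?_⟩
  · ext s
    exact (affineLift p e' _ _ key).commutes s
  · refine affineRing_ringHom_ext ?_ ?_ ?_
    · ext r
      change affineLift p e' _ _ key (affineTwist h (algebraMap R _ r)) = _
      rw [AlgHom.commutes, IsScalarTower.algebraMap_apply R S, AlgHom.commutes, hα, hβ]
      rfl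
    · change affineLift p e' _ _ key (affineTwist h (x p e)) = _
      rw [affineTwist, affineLift_x, map_mul, AlgHom.commutes, affineLift_x, hα, ← mul_assoc,
        mul_comm (α a), hinv, one_mul]
    · change affineLift p e' _ _ key (affineTwist h (y p e)) = _
      rw [affineTwist, affineLift_y, map_mul, AlgHom.commutes, affineLift_y, hα, ← mul_assoc,
        mul_comm (α c), hinv, one_mul]
  · rintro γ ⟨h1, h2⟩
    have h1' : ∀ s, γ (algebraMap S _ s) = α s := RingHom.congr_fun h1
    refine affineRing_ringHom_ext ?_ ?_ ?_
    · rw [h1]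
      ext s
      exact ((affineLift p e' _ _ key).commutes s).symm
    · change _ = affineLift p e' _ _ key (x p e')
      have : γ (affineTwist h (x p e)) = β (x p e) := RingHom.congr_fun h2 _
      rw [affineLift_x, ← this, affineTwist, affineLift_x, map_mul, h1', ← mul_assoc, hinv, one_mul]
    · change _ = affineLift p e' _ _ key (y p e')
      have : γ (affineTwist h (y p e)) = β (y p e) := RingHom.congr_fun h2 _
      rw [affineLift_y, ← this, affineTwist, affineLift_y, map_mul, h1', ← mul_assoc, hinv, one_mul]

theorem isPushout_infinityTwist {a c : Sˣ} (h : IsTwist p e e' a c) :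
    IsPushout (CommRingCat.ofHom (algebraMap R S))
      (CommRingCat.ofHom (algebraMap R (InfinityRing p e)))
      (CommRingCat.ofHom (algebraMap S (InfinityRing p e')))
      (CommRingCat.ofHom (infinityTwist h).toRingHom) := by
  refine CommRingCat.isPushout_of_existsUnique ?_ fun T _ α β hαβ => ?_
  · ext r
    exact ((infinityTwist h).commutes r).symm
  let := α.toAlgebra
  have hα : ∀ s, algebraMap S T s = α s := fun _ => rfl
  have hinv : ∀ s : Sˣ, α ↑s⁻¹ * α s = 1 := fun s => by rw [← map_mul, s.inv_mul, map_one]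
  have hβ : ∀ r, α (algebraMap R S r) = β (algebraMap R _ r) := RingHom.congr_fun hαβ
  have key : α ↑c⁻¹ * β (v p e) - (α ↑c⁻¹ * β (v p e)) ^ p -
      algebraMap S T e' * (α ↑a⁻¹ * β (u p e)) ^ 2 = 0 := by
    have h1 := congrArg α h.eq
    have hc : c⁻¹ ^ p = c⁻¹ := by rw [inv_pow, show c ^ p = c from Units.ext h.pow]
    have h2 : α ↑c⁻¹ ^ p = α ↑c⁻¹ := by
      rw [← map_pow, ← Units.val_pow_eq_pow_val, hc]
    have h3 := congrArg β (u_v_eq p e)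
    simp only [map_sub, map_mul, map_pow, map_zero, hβ] at h1 h3
    rw [mul_pow, h2, hα]
    have h4 := hinv a
    have h5 := hinv c
    linear_combination α ↑c⁻¹ * h3 + α ↑c⁻¹ * (α ↑a⁻¹ * β (u p e)) ^ 2 * h1 +
      (α e' * (α ↑a⁻¹ * β (u p e)) ^ 2) * h5 -
      α ↑c⁻¹ * β (algebraMap R _ e) * β (u p e) ^ 2 * (α ↑a⁻¹ * α a + 1) * h4
  refine ⟨(infinityLift p e' _ _ key).toRingHom, ⟨?_, ?_⟩, ?_⟩
  · ext s
    exact (infinityLift p e' _ _ key).commutes s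
  · refine infinityRing_ringHom_ext ?_ ?_ ?_
    · ext r
      change infinityLift p e' _ _ key (infinityTwist h (algebraMap R _ r)) = _
      rw [AlgHom.commutes, IsScalarTower.algebraMap_apply R S, AlgHom.commutes, hα, hβ]
      rfl
    · change infinityLift p e' _ _ key (infinityTwist h (u p e)) = _
      rw [infinityTwist, infinityLift_u, map_mul, AlgHom.commutes, infinityLift_u, hα,
        ← mul_assoc, mul_comm (α a), hinv, one_mul]
    · change infinityLift p e' _ _ key (infinityTwist h (v p e)) = _
      rw [infinityTwist, infinityLift_v, map_mul, AlgHom.commutes, infinityLift_v, hα,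
        ← mul_assoc, mul_comm (α c), hinv, one_mul]
  · rintro γ ⟨h1, h2⟩
    have h1' : ∀ s, γ (algebraMap S _ s) = α s := RingHom.congr_fun h1
    refine infinityRing_ringHom_ext ?_ ?_ ?_
    · rw [h1]
      ext s
      exact ((infinityLift p e' _ _ key).commutes s).symm
    · change _ = infinityLift p e' _ _ key (u p e')
      have : γ (infinityTwist h (u p e)) = β (u p e) := RingHom.congr_fun h2 _
      rw [infinityLift_u, ← this, infinityTwist, infinityLift_u, map_mul, h1', ← mul_assoc, hinv,
        one_mul]
    · change _ = infinityLift p e' _ _ key (v p e')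
      have : γ (infinityTwist h (v p e)) = β (v p e) := RingHom.congr_fun h2 _
      rw [infinityLift_v, ← this, infinityTwist, infinityLift_v, map_mul, h1', ← mul_assoc, hinv,
        one_mul]

/-- The extension of `affineTwist` to the overlaps. -/
def overlapTwist {a c : Sˣ} (h : IsTwist p e e' a c) :
    AffineOverlap p e →ₐ[R] AffineOverlap p e' :=
  IsLocalization.liftAlgHom (M := Submonoid.powers (y p e))
    (f := (IsScalarTower.toAlgHom R (AffineRing p e') (AffineOverlap p e')).comp (affineTwist h))
    (by
      rintro ⟨_, n, rfl⟩
      rw [map_pow]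
      refine IsUnit.pow n ?_
      rw [AlgHom.comp_apply, affineTwist, affineLift_y, map_mul]
      exact (((c.isUnit.map (algebraMap S (AffineRing p e'))).map _)).mul
        (IsUnit.of_mul_eq_one _ (y_mul_yInv p e')))

theorem overlapTwist_algebraMap {a c : Sˣ} (h : IsTwist p e e' a c) (z : AffineRing p e) :
    overlapTwist h (algebraMap _ _ z) = algebraMap _ _ (affineTwist h z) :=
  IsLocalization.lift_eq _ z

theorem overlapTwist_yInv {a c : Sˣ} (h : IsTwist p e e' a c) :
    overlapTwist h (yInv p e) = algebraMap S _ ↑c⁻¹ * yInv p e' := by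
  have h1 := congrArg (overlapTwist h) (y_mul_yInv p e)
  rw [map_mul, overlapTwist_algebraMap, affineTwist, affineLift_y, map_mul, map_one,
    ← IsScalarTower.algebraMap_apply] at h1
  have h2 := y_mul_yInv p e'
  have h3 : algebraMap S (AffineOverlap p e') ↑c⁻¹ * algebraMap S (AffineOverlap p e') c = 1 := by
    rw [← map_mul, c.inv_mul, map_one]
  linear_combination (algebraMap S (AffineOverlap p e') ↑c⁻¹ * yInv p e') * h1 -
    overlapTwist h (yInv p e) * (h2 + algebraMap _ _ (y p e') * yInv p e' * h3)

/-- The scalings of the two charts agree on the overlap; this dictates the factors in `IsTwist.inv`.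
-/
theorem overlapTwist_comp_infinityToAffineOverlap (hp : Odd p) {a c : Sˣ}
    (h : IsTwist p e e' a c) (z : InfinityRing p e) :
    overlapTwist h (infinityToAffineOverlap p hp e z) =
      infinityToAffineOverlap p hp e' (infinityTwist (h.inv hp) z) := by
  have : (overlapTwist h).comp (infinityToAffineOverlap p hp e) =
      ((infinityToAffineOverlap p hp e').restrictScalars R).comp (infinityTwist (h.inv hp)) := by
    apply infinityRing_hom_ext
    · change overlapTwist h (infinityToAffineOverlap p hp e (u p e)) =
        infinityToAffineOverlap p hp e' (infinityTwist (h.inv hp) (u p e))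
      rw [infinityTwist, infinityLift_u, map_mul, AlgHom.commutes, infinityToAffineOverlap,
        infinityToAffineOverlap, infinityLift_u, infinityLift_u, map_mul, map_pow,
        overlapTwist_yInv, overlapTwist_algebraMap, affineTwist, affineLift_x, map_mul,
        ← IsScalarTower.algebraMap_apply, Units.val_mul, Units.val_pow_eq_pow_val, map_mul,
        map_pow]
      ring
    · change overlapTwist h (infinityToAffineOverlap p hp e (v p e)) =
        infinityToAffineOverlap p hp e' (infinityTwist (h.inv hp) (v p e))
      rw [infinityTwist, infinityLift_v, map_mul, AlgHom.commutes, infinityToAffineOverlap,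
        infinityToAffineOverlap, infinityLift_v, infinityLift_v, overlapTwist_yInv]
  exact DFunLike.congr_fun this z

/-! ### Cartesian squares of curves, isomorphisms and base change. -/

section

variable {R S : Type u} [CommRing R] [CommRing S] [Algebra R S] {p : ℕ} {e : R} {e' : S}

theorem mem_range_overlapToAffine (q : affineChart p e) :
    q ∈ Set.range (overlapToAffine p e) ↔ y p e ∉ PrimeSpectrum.asIdeal q :=
  Set.ext_iff.1 (PrimeSpectrum.localization_away_comap_range (AffineOverlap p e) (y p e)) q

/-- Up to the isomorphism of overlaps, the map is the inclusion of the basic open set `V ≠ 0`. -/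
theorem mem_range_overlapToInfinity (hp : Odd p) (q : infinityChart p e) :
    q ∈ Set.range (overlapToInfinity p hp e) ↔ v p e ∉ PrimeSpectrum.asIdeal q := by
  refine Iff.trans ?_ (Set.ext_iff.1
    (PrimeSpectrum.localization_away_comap_range (InfinityOverlap p e) (v p e)) q)
  constructor
  · rintro ⟨z, rfl⟩
    refine ⟨PrimeSpectrum.comap (overlapHom p hp e).toRingHom z, PrimeSpectrum.ext ?_⟩
    ext a
    exact iff_of_eq (congrArg (· ∈ PrimeSpectrum.asIdeal (R := AffineOverlap p e) z)
      (overlapHom_algebraMap p hp e a))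
  · rintro ⟨w, rfl⟩
    refine ⟨PrimeSpectrum.comap (overlapInv p hp e).toRingHom w, PrimeSpectrum.ext ?_⟩
    ext a
    refine iff_of_eq (congrArg (· ∈ w.asIdeal) ?_)
    change overlapInv p hp e (infinityToAffineOverlap p hp e a) = algebraMap _ _ a
    rw [← overlapHom_algebraMap]
    exact DFunLike.congr_fun (overlapInv_comp_overlapHom p hp e) (algebraMap _ _ a)

/-- Scaling the coordinates by `a` and `c`, together with a change of base, is a cartesian
morphism of curves. -/
theorem isPullback_twist (hp : Odd p) {a c : Sˣ} (h : IsTwist p e e' a c) :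
    ∃ φ : (artinSchreierCurve p hp e').left ⟶ (artinSchreierCurve p hp e).left,
      IsPullback φ (artinSchreierCurve p hp e').hom (artinSchreierCurve p hp e).hom
        (Spec.map (CommRingCat.ofHom (algebraMap R S))) := by
  refine ⟨pushout.map _ _ _ _ (Spec.map (CommRingCat.ofHom (affineTwist h).toRingHom))
    (Spec.map (CommRingCat.ofHom (infinityTwist (h.inv hp)).toRingHom))
    (Spec.map (CommRingCat.ofHom (overlapTwist h).toRingHom)) ?_ ?_,
    isPullback_pushout_map _ _ _ _ _ _ _ _ _ ?_ ?_ _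
      (pushout.desc (affineStructure p e) (infinityStructure p e) (structure_compat p hp e))
      (pushout.desc (affineStructure p e') (infinityStructure p e') (structure_compat p hp e'))
      ?_ ?_⟩
  · rw [overlapToAffine, overlapToAffine, ← Spec.map_comp, ← Spec.map_comp]
    exact congrArg Spec.map (CommRingCat.hom_ext (RingHom.ext fun z =>
      (overlapTwist_algebraMap h z).symm))
  · rw [overlapToInfinity, overlapToInfinity, ← Spec.map_comp, ← Spec.map_comp]
    exact congrArg Spec.map (CommRingCat.hom_ext (RingHom.ext fun z =>
      (overlapTwist_comp_infinityToAffineOverlap hp h z).symm))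
  -- `Y` is sent to a multiple of `Y`, so it cannot vanish at `q` without vanishing at the image of
  -- `q`. The same holds for `V` below.
  · intro q hq
    rw [mem_range_overlapToAffine] at hq ⊢
    intro hy
    refine hq ?_
    change affineTwist h (y p e) ∈ q.asIdeal
    rw [affineTwist, affineLift_y]
    exact q.asIdeal.mul_mem_left _ hy
  · intro q hq
    rw [mem_range_overlapToInfinity] at hq ⊢
    intro hv
    refine hq ?_
    change infinityTwist (h.inv hp) (v p e) ∈ q.asIdeal
    rw [infinityTwist, infinityLift_v]
    exact q.asIdeal.mul_mem_left _ hv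
  · rw [pushout.inl_desc, pushout.inl_desc]
    exact (isPullback_SpecMap_of_isPushout _ _ _ _ (isPushout_affineTwist h).flip)
  · rw [pushout.inr_desc, pushout.inr_desc]
    exact (isPullback_SpecMap_of_isPushout _ _ _ _ (isPushout_infinityTwist (h.inv hp)).flip)

theorem nonempty_iso_of_isTwist (hp : Odd p) {e e' : R} {a c : Rˣ} (h : IsTwist p e e' a c) :
    Nonempty (artinSchreierCurve p hp e' ≅ artinSchreierCurve p hp e) := by
  obtain ⟨φ, hφ⟩ := isPullback_twist hp h
  have h1 : Spec.map (CommRingCat.ofHom (algebraMap R R)) = 𝟙 _ := Spec.map_id _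
  rw [h1] at hφ
  have := hφ.isIso_fst_of_isIso
  exact ⟨Over.isoMk (asIso φ) (hφ.w.trans (Category.comp_id _))⟩

theorem nonempty_baseChange_iso_of_isTwist (hp : Odd p) {a c : Sˣ} (h : IsTwist p e e' a c) :
    Nonempty (schemeBaseChange S (artinSchreierCurve p hp e) ≅ artinSchreierCurve p hp e') := by
  obtain ⟨φ, hφ⟩ := isPullback_twist hp h
  exact ⟨(Over.isoMk hφ.isoPullback hφ.isoPullback_hom_snd).symm⟩

end

/-! ### Rational points, as sections of the structure morphism. -/

section

variable {F : Type u} [Field F] {p : ℕ} {e : F}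

/-- The solutions `(X, Y)` of `Y ^ p - Y = e X ^ 2` in `F`. -/
abbrev AffineSolution (p : ℕ) (e : F) : Type u :=
  {q : F × F // q.2 ^ p - q.2 - e * q.1 ^ 2 = 0}

/-- The section of the curve given by a solution of the affine equation. -/
def affinePoint (hp : Odd p) (q : AffineSolution p e) :
    Over.mk (𝟙 (Spec (.of F))) ⟶ artinSchreierCurve p hp e :=
  Over.homMk (Spec.map (CommRingCat.ofHom (affineLift p e q.1.1 q.1.2 q.2).toRingHom) ≫
    pushout.inl (overlapToAffine p e) (overlapToInfinity p hp e)) (by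
      refine (Category.assoc _ _ _).trans ?_
      refine (congrArg (_ ≫ ·) (pushout.inl_desc (affineStructure p e) (infinityStructure p e)
        (structure_compat p hp e))).trans ?_
      refine (Spec.map_comp _ _).symm.trans ?_
      refine (congrArg Spec.map (CommRingCat.hom_ext (RingHom.ext fun r => ?_))).trans
        (Spec.map_id _)
      exact (affineLift p e q.1.1 q.1.2 q.2).commutes r)

/-- The point at infinity `U = V = 0`. -/
def infinityPoint (hp : Odd p) (e : F) :
    Over.mk (𝟙 (Spec (.of F))) ⟶ artinSchreierCurve p hp e :=
  have h : (0 : F) - 0 ^ p - algebraMap F F e * 0 ^ 2 = 0 := by simp [hp.pos.ne']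
  Over.homMk (Spec.map (CommRingCat.ofHom (infinityLift p e 0 0 h).toRingHom) ≫
    pushout.inr (overlapToAffine p e) (overlapToInfinity p hp e)) (by
      refine (Category.assoc _ _ _).trans ?_
      refine (congrArg (_ ≫ ·) (pushout.inr_desc (affineStructure p e) (infinityStructure p e)
        (structure_compat p hp e))).trans ?_
      refine (Spec.map_comp _ _).symm.trans ?_
      refine (congrArg Spec.map (CommRingCat.hom_ext (RingHom.ext fun r => ?_))).trans
        (Spec.map_id _)
      exact (infinityLift p e 0 0 h).commutes r)

theorem affinePoint_injective (hp : Odd p) :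
    Function.Injective (affinePoint hp : AffineSolution p e → _) := by
  intro q q' h
  have h1 := Spec.map_injective ((cancel_mono
    (pushout.inl (overlapToAffine p e) (overlapToInfinity p hp e))).1
      (congrArg CommaMorphism.left h))
  have h2 : ∀ z, affineLift p e q.1.1 q.1.2 q.2 z = affineLift p e q'.1.1 q'.1.2 q'.2 z :=
    RingHom.congr_fun (congrArg CommRingCat.Hom.hom h1)
  have hx := h2 (x p e)
  have hy := h2 (y p e)
  rw [affineLift_x, affineLift_x] at hx
  rw [affineLift_y, affineLift_y] at hy
  exact Subtype.ext (Prod.ext hx hy)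

/-- Equality would place the point at infinity in the overlap, where `V` does not vanish. -/
theorem affinePoint_ne_infinityPoint (hp : Odd p) (q : AffineSolution p e) :
    affinePoint hp q ≠ infinityPoint hp e := by
  intro h
  have h1 := congrArg (fun s : Over.mk (𝟙 (Spec (.of F))) ⟶ artinSchreierCurve p hp e =>
    s.left (⊥ : PrimeSpectrum F)) h
  obtain ⟨z, -, hz⟩ := exists_of_pushout_inl_eq_inr (overlapToAffine p e)
    (overlapToInfinity p hp e) (x := Spec.map (CommRingCat.ofHom
      (affineLift p e q.1.1 q.1.2 q.2).toRingHom) (⊥ : PrimeSpectrum F)) h1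
  refine (mem_range_overlapToInfinity hp _).1 ⟨z, hz⟩ ?_
  exact (Submodule.mem_bot F).2 (infinityLift_v p e 0 0 (by simp [hp.pos.ne']))

/-- `Spec F` is a single point, so a section factors through one chart and amounts to an algebra map
from its coordinate ring to `F`. If it misses the affine chart, then `V = 0`, and the equation
leaves `e * U ^ 2 = 0`, so `U = 0` because `e ≠ 0`. -/
theorem exists_affinePoint_or_eq_infinityPoint (hp : Odd p) (he : e ≠ 0)
    (s : Over.mk (𝟙 (Spec (.of F))) ⟶ artinSchreierCurve p hp e) :
    (∃ q, affinePoint hp q = s) ∨ infinityPoint hp e = s := by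
  have hs : s.left ≫ (artinSchreierCurve p hp e).hom = 𝟙 (Spec (.of F)) := Over.w s
  have hrange {Z : Scheme.{u}} (i : Z ⟶ (artinSchreierCurve p hp e).left) (z : Z)
      (hz : i z = s.left (⊥ : PrimeSpectrum F)) : Set.range s.left ⊆ Set.range i := by
    rintro _ ⟨w, rfl⟩
    exact ⟨z, hz.trans (congrArg s.left (Subsingleton.elim (α := PrimeSpectrum F) _ w))⟩
  by_cases hl : ∃ z, pushout.inl (overlapToAffine p e) (overlapToInfinity p hp e) z =
      s.left (⊥ : PrimeSpectrum F)
  · obtain ⟨z, hz⟩ := hl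
    obtain ⟨φ, hφ⟩ := Spec.map_surjective (IsOpenImmersion.lift
      (pushout.inl (overlapToAffine p e) (overlapToInfinity p hp e)) s.left (hrange _ z hz))
    have hfac := IsOpenImmersion.lift_fac
      (pushout.inl (overlapToAffine p e) (overlapToInfinity p hp e)) s.left (hrange _ z hz)
    rw [← hφ] at hfac
    have hstr : Spec.map φ ≫ affineStructure p e = 𝟙 _ := by
      refine Eq.trans ?_ hs
      rw [← hfac]
      refine Eq.trans ?_ (Category.assoc _ _ _).symm
      exact congrArg (_ ≫ ·) (pushout.inl_desc (affineStructure p e) (infinityStructure p e)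
        (structure_compat p hp e)).symm
    have hcomm : ∀ r, φ.hom (algebraMap F _ r) = r := by
      rw [affineStructure, ← Spec.map_comp, ← Spec.map_id] at hstr
      exact RingHom.congr_fun (congrArg CommRingCat.Hom.hom (Spec.map_injective hstr))
    let ψ : AffineRing p e →ₐ[F] F := { φ.hom with commutes' := hcomm }
    have hψ : ψ (y p e) ^ p - ψ (y p e) - e * ψ (x p e) ^ 2 = 0 := by
      have := congrArg ψ (x_y_eq p e)
      simpa only [map_sub, map_mul, map_pow, map_zero, AlgHom.commutes, Algebra.algebraMap_self,
        RingHom.id_apply] using this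
    refine .inl ⟨⟨(ψ (x p e), ψ (y p e)), hψ⟩, Over.OverMorphism.ext ?_⟩
    refine Eq.trans ?_ hfac
    have : affineLift p e (ψ (x p e)) (ψ (y p e)) hψ = ψ :=
      affineRing_hom_ext (affineLift_x _ _ _ _ _) (affineLift_y _ _ _ _ _)
    refine congrArg (· ≫ _) (congrArg Spec.map (CommRingCat.hom_ext (RingHom.ext fun a => ?_)))
    exact DFunLike.congr_fun this a
  · obtain h | ⟨z, hz⟩ := pushout_inl_or_inr (overlapToAffine p e) (overlapToInfinity p hp e)
      (s.left (⊥ : PrimeSpectrum F))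
    · exact absurd h hl
    obtain ⟨φ, hφ⟩ := Spec.map_surjective (IsOpenImmersion.lift
      (pushout.inr (overlapToAffine p e) (overlapToInfinity p hp e)) s.left (hrange _ z hz))
    have hfac := IsOpenImmersion.lift_fac
      (pushout.inr (overlapToAffine p e) (overlapToInfinity p hp e)) s.left (hrange _ z hz)
    rw [← hφ] at hfac
    have hstr : Spec.map φ ≫ infinityStructure p e = 𝟙 _ := by
      refine Eq.trans ?_ hs
      rw [← hfac]
      refine Eq.trans ?_ (Category.assoc _ _ _).symm
      exact congrArg (_ ≫ ·) (pushout.inr_desc (affineStructure p e) (infinityStructure p e)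
        (structure_compat p hp e)).symm
    have hcomm : ∀ r, φ.hom (algebraMap F _ r) = r := by
      rw [infinityStructure, ← Spec.map_comp, ← Spec.map_id] at hstr
      exact RingHom.congr_fun (congrArg CommRingCat.Hom.hom (Spec.map_injective hstr))
    let ψ : InfinityRing p e →ₐ[F] F := { φ.hom with commutes' := hcomm }
    have hv : ψ (v p e) = 0 := by
      by_contra hv
      obtain ⟨w, hw⟩ := (mem_range_overlapToInfinity hp (Spec.map φ (⊥ : PrimeSpectrum F))).2
        fun h => hv ((Submodule.mem_bot F).1 h)
      refine hl ⟨overlapToAffine p e w, ?_⟩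
      rw [← Scheme.Hom.comp_apply, pushout.condition, Scheme.Hom.comp_apply, hw, ← hfac]
      rfl
    have hu : ψ (u p e) = 0 := by
      have := congrArg ψ (u_v_eq p e)
      simpa [hv, he, hp.pos.ne'] using this
    refine .inr (Over.OverMorphism.ext (Eq.trans ?_ hfac))
    have : infinityLift p e 0 0 (by simp [hp.pos.ne']) = ψ :=
      infinityRing_hom_ext ((infinityLift_u _ _ _ _ _).trans hu.symm)
        ((infinityLift_v _ _ _ _ _).trans hv.symm)
    refine congrArg (· ≫ _) (congrArg Spec.map (CommRingCat.hom_ext (RingHom.ext fun a => ?_)))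
    exact DFunLike.congr_fun this a

/-- The rational points of the curve are the solutions of the affine equation, and one point at
infinity. -/
theorem natCard_sections (hp : Odd p) (he : e ≠ 0) [Finite F] :
    Nat.card (Over.mk (𝟙 (Spec (.of F))) ⟶ artinSchreierCurve p hp e) =
      Nat.card (AffineSolution p e) + 1 := by
  rw [← Finite.card_option]
  refine (Nat.card_eq_of_bijective
    (fun o : Option (AffineSolution p e) => o.elim (infinityPoint hp e) (affinePoint hp))
    ⟨?_, ?_⟩).symm
  · rintro (_ | q) (_ | q') h
    · rfl
    · exact absurd h.symm (affinePoint_ne_infinityPoint hp q')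
    · exact absurd h (affinePoint_ne_infinityPoint hp q)
    · exact congrArg some (affinePoint_injective hp h)
  · intro s
    obtain ⟨q, hq⟩ | h := exists_affinePoint_or_eq_infinityPoint hp he s
    · exact ⟨some q, hq⟩
    · exact ⟨none, h⟩

theorem natCard_affineSolution_eq_of_iso (hp : Odd p) [Finite F] {e₁ e₂ : F} (h₁ : e₁ ≠ 0)
    (h₂ : e₂ ≠ 0) (i : artinSchreierCurve p hp e₁ ≅ artinSchreierCurve p hp e₂) :
    Nat.card (AffineSolution p e₁) = Nat.card (AffineSolution p e₂) := by
  have := Nat.card_congr (i.homToEquiv (Z := Over.mk (𝟙 (Spec (.of F)))))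
  rw [natCard_sections hp h₁, natCard_sections hp h₂] at this
  exact Nat.succ_injective this

end

/-! ### Counting solutions over a finite field. -/

section

variable {F : Type u} [Field F] {p : ℕ}

theorem quadraticChar_div_of_not_isSquare [Fintype F] [DecidableEq F] {e₁ e₂ : F}
    (h₁ : e₁ ≠ 0) (h : ¬IsSquare (e₁ / e₂)) (z : F) :
    quadraticChar F (z / e₂) = -quadraticChar F (z / e₁) := by
  have h' : quadraticChar F (e₁ / e₂) = -1 := quadraticChar_neg_one_iff_not_isSquare.2 h
  rw [← div_mul_div_cancel₀ h₁ (a := z), map_mul, h', mul_neg_one]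

theorem isSquare_div_of_not_isSquare [Finite F] {a b : F} (ha : ¬IsSquare a)
    (hb : ¬IsSquare b) : IsSquare (a / b) := by
  classical
  have := Fintype.ofFinite F
  have hb0 : b ≠ 0 := by rintro rfl; exact hb (.zero)
  by_contra h
  have h1 := quadraticChar_neg_one_iff_not_isSquare.2 h
  have h2 := quadraticChar_neg_one_iff_not_isSquare.2 ha
  have h3 := quadraticChar_neg_one_iff_not_isSquare.2 hb
  rw [← div_mul_cancel₀ a hb0, map_mul, h1, h3] at h2
  norm_num at h2

/-- Solutions are counted by their `Y`-coordinate: `z` has `1 + χ(z)` square roots, also for `z =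
0`. -/
theorem natCard_affineSolution (hF : ringChar F ≠ 2) [Fintype F] [DecidableEq F] {e : F}
    (he : e ≠ 0) :
    (Nat.card (AffineSolution p e) : ℤ) = ∑ y : F, (quadraticChar F ((y ^ p - y) / e) + 1) := by
  let E : AffineSolution p e ≃ Σ y : F, {x : F // x ^ 2 = (y ^ p - y) / e} :=
    { toFun q := ⟨q.1.2, q.1.1, by rw [eq_div_iff he]; linear_combination -q.2⟩
      invFun q := ⟨(q.2.1, q.1), by
        have := q.2.2
        rw [eq_div_iff he] at this
        linear_combination -this⟩
      left_inv _ := rfl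
      right_inv _ := rfl }
  rw [Nat.card_congr E, Nat.card_sigma, Nat.cast_sum]
  refine Finset.sum_congr rfl fun y _ => ?_
  rw [← quadraticChar_card_sqrts hF, Set.toFinset_card, Nat.card_eq_fintype_card]
  rfl

/-- The curves of two coefficients with nonsquare quotient have together `2 * q` affine points. -/
theorem natCard_affineSolution_add [Finite F] (hF : ringChar F ≠ 2) {e₁ e₂ : F} (h₁ : e₁ ≠ 0) (h₂ : e₂ ≠ 0)
    (h : ¬IsSquare (e₁ / e₂)) :
    Nat.card (AffineSolution p e₁) + Nat.card (AffineSolution p e₂) = 2 * Nat.card F := by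
  classical
  have := Fintype.ofFinite F
  zify
  -- For each `y` the two characters are opposite, so the two terms add up to `2`.
  rw [natCard_affineSolution hF h₁, natCard_affineSolution hF h₂, ← Finset.sum_add_distrib,
    Finset.sum_congr rfl fun y _ => show _ = (2 : ℤ) by
      rw [quadraticChar_div_of_not_isSquare h₁ h]; ring]
  simp [mul_comm]

/-- The solutions of `Y ^ p - Y = e X ^ 2` with `X ≠ 0`. -/
abbrev NonzeroSolution (p : ℕ) (e : F) : Type u := {q : AffineSolution p e // q.1.1 ≠ 0}

/-- For `X = 0` the equation reads `Y ^ p = Y`, whose solutions form the prime field. -/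
theorem natCard_affineSolution_eq_add [Finite F] [Fact p.Prime] [CharP F p] (e : F) :
    Nat.card (AffineSolution p e) = Nat.card (NonzeroSolution p e) + p := by
  classical
  let E : {q : AffineSolution p e // ¬q.1.1 ≠ 0} ≃ (⊥ : Subfield F) :=
    { toFun q := ⟨q.1.1.2, (Subfield.mem_bot_iff_pow_eq_self F p).2 (by
        have h := q.1.2
        rw [not_not.1 q.2] at h
        linear_combination h)⟩
      invFun y := ⟨⟨(0, y), by
        have h := (Subfield.mem_bot_iff_pow_eq_self F p).1 y.2
        linear_combination h⟩, fun h => h rfl⟩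
      left_inv q := Subtype.ext (Subtype.ext (Prod.ext (not_not.1 q.2).symm rfl))
      right_inv _ := rfl }
  rw [← Nat.card_congr (Equiv.sumCompl fun q : AffineSolution p e => q.1.1 ≠ 0), Nat.card_sum,
    Nat.card_congr E, Subfield.card_bot F p]

/-- The group generated by `s`, for `s ^ 2 ∈ 𝔽_p`, acts by `(X, Y) ↦ (g X, g ^ 2 Y)`. -/
theorem orderOf_dvd_natCard_nonzeroSolution [Finite F] {s : Fˣ} (hs : (s ^ 2) ^ p = s ^ 2) (e : F) :
    orderOf s ∣ Nat.card (NonzeroSolution p e) := by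
  have hpow : ∀ g : Subgroup.zpowers s, (((g : Fˣ) : F) ^ 2) ^ p = ((g : Fˣ) : F) ^ 2 := by
    rintro ⟨g, k, hk : s ^ k = g⟩
    have h : (g ^ 2) ^ p = g ^ 2 := by
      rw [← hk, ← zpow_natCast (s ^ k) 2, zpow_comm, ← zpow_natCast _ p, zpow_comm,
        zpow_natCast, zpow_natCast, hs]
    exact congrArg Units.val h
  let A : MulAction (Subgroup.zpowers s) (NonzeroSolution p e) :=
    { smul g q := ⟨⟨(((g : Fˣ) : F) * q.1.1.1, ((g : Fˣ) : F) ^ 2 * q.1.1.2), by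
        have h := q.1.2
        rw [mul_pow, mul_pow, hpow]
        linear_combination ((g : Fˣ) : F) ^ 2 * h⟩,
        mul_ne_zero (g : Fˣ).ne_zero q.2⟩
      one_smul q := Subtype.ext (Subtype.ext (Prod.ext (one_mul _)
        ((congrArg (· * _) (one_pow 2)).trans (one_mul _))))
      mul_smul g h q := Subtype.ext (Subtype.ext (Prod.ext (mul_assoc _ _ _)
        ((congrArg (· * _) (mul_pow _ _ 2)).trans (mul_assoc _ _ _)))) }
  have hfree : ∀ q : NonzeroSolution p e, MulAction.stabilizer (Subgroup.zpowers s) q = ⊥ := by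
    intro q
    refine (Subgroup.eq_bot_iff_forall _).2 fun g hg => ?_
    have h1 : ((g : Fˣ) : F) * q.1.1.1 = q.1.1.1 :=
      congrArg (fun r : NonzeroSolution p e => r.1.1.1) hg
    exact Subtype.ext (Units.ext (mul_right_cancel₀ q.2 (h1.trans (one_mul _).symm)))
  rw [Nat.card_congr (MulAction.selfEquivOrbitsQuotientProd hfree), Nat.card_prod,
    Nat.card_zpowers]
  exact dvd_mul_left _ _

/-- If all elements of `𝔽_p` are squares in `F`, then `F` contains roots of unity of order
`2 * (p - 1)`. -/
theorem exists_orderOf_eq [Fact p.Prime] (hp : Odd p) [Algebra (ZMod p) F]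
    (h : ∀ c : ZMod p, IsSquare (algebraMap (ZMod p) F c)) :
    ∃ s : Fˣ, orderOf s = 2 * (p - 1) ∧ (s ^ 2) ^ p = s ^ 2 := by
  obtain ⟨c, hc⟩ := IsCyclic.exists_ofOrder_eq_natCard (α := (ZMod p)ˣ)
  rw [Nat.card_eq_fintype_card, ZMod.card_units] at hc
  obtain ⟨r, hr⟩ := h c
  have hr0 : r ≠ 0 := by
    rintro rfl
    rw [mul_zero] at hr
    exact c.ne_zero ((map_eq_zero _).1 hr)
  have hs : Units.mk0 r hr0 ^ 2 = Units.map (algebraMap (ZMod p) F).toMonoidHom c :=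
    Units.ext ((pow_two r).trans hr.symm)
  have ho : orderOf (Units.mk0 r hr0 ^ 2) = p - 1 := by
    rw [hs, orderOf_injective _ (Units.map_injective (algebraMap (ZMod p) F).injective), hc]
  refine ⟨Units.mk0 r hr0, ?_, ?_⟩
  -- The order of `s` is a multiple of the even number `p - 1`, hence even, so squaring `s` halves
  -- it exactly.
  · have heven : 2 ∣ p - 1 := (Nat.Odd.sub_odd hp odd_one).two_dvd
    have h2 : 2 ∣ orderOf (Units.mk0 r hr0) := heven.trans (ho ▸ orderOf_pow_dvd 2)
    rw [orderOf_pow_of_dvd two_ne_zero h2] at ho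
    omega
  · conv_lhs => rw [← Nat.sub_add_cancel hp.pos, pow_succ, ← ho, pow_orderOf_eq_one, one_mul]

/-- A nonsquare quotient would make both counts equal to `q`, against the free action of a group of
order `2 * (p - 1)`. -/
theorem isSquare_div_of_natCard_eq [Finite F] [Fact p.Prime] (hp : Odd p) [Algebra (ZMod p) F] {e₁ e₂ : F}
    (h₁ : e₁ ≠ 0) (h₂ : e₂ ≠ 0) (hc : ∀ c : ZMod p, IsSquare (algebraMap (ZMod p) F c))
    (h : Nat.card (AffineSolution p e₁) = Nat.card (AffineSolution p e₂)) :
    IsSquare (e₁ / e₂) := by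
  have : CharP F p := charP_of_injective_algebraMap (algebraMap (ZMod p) F).injective p
  have hF : ringChar F ≠ 2 := by rw [ringChar.eq F p]; rintro rfl; exact absurd hp (by decide)
  by_contra hsq
  obtain ⟨s, hs, hs'⟩ := exists_orderOf_eq hp hc
  have hq := natCard_affineSolution_add (p := p) hF h₁ h₂ hsq
  rw [← h, ← two_mul] at hq
  have hq' := natCard_affineSolution_eq_add (p := p) e₁
  rw [Nat.eq_of_mul_eq_mul_left two_pos hq] at hq'
  have d1 := orderOf_dvd_natCard_nonzeroSolution hs' e₁
  have d2 : orderOf s ∣ Nat.card F - 1 := by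
    rw [← Nat.card_units]
    exact orderOf_dvd_natCard s
  rw [hs] at d1 d2
  have hp2 := (Fact.out : p.Prime).two_le
  rw [hq', Nat.add_sub_assoc (by omega)] at d2
  -- In `q - 1 = n + (p - 1)`, with `n` the number of solutions with `X ≠ 0`, both `q - 1` and `n`
  -- are multiples of `2 * (p - 1)`.
  have := Nat.le_of_dvd (by omega) ((Nat.dvd_add_right d1).1 d2)
  omega

theorem exists_of_natCard_eq [Finite F] [Fact p.Prime] (hp : Odd p) [Algebra (ZMod p) F] {e₁ e₂ : F}
    (h₁ : e₁ ≠ 0) (h₂ : e₂ ≠ 0)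
    (h : Nat.card (AffineSolution p e₁) = Nat.card (AffineSolution p e₂)) :
    ∃ s : F, s ≠ 0 ∧ ∃ c : ZMod p, c ≠ 0 ∧ e₁ / e₂ = s ^ 2 * algebraMap (ZMod p) F c := by
  have : CharP F p := charP_of_injective_algebraMap (algebraMap (ZMod p) F).injective p
  have hF : ringChar F ≠ 2 := by rw [ringChar.eq F p]; rintro rfl; exact absurd hp (by decide)
  have h0 : e₁ / e₂ ≠ 0 := div_ne_zero h₁ h₂
  obtain ⟨c, hc0, s, hs⟩ : ∃ c : ZMod p, c ≠ 0 ∧ IsSquare (e₁ / e₂ / algebraMap (ZMod p) F c) := by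
    by_cases hsq : IsSquare (e₁ / e₂)
    · exact ⟨1, one_ne_zero, by rwa [map_one, div_one]⟩
    -- Some element of `𝔽_p` is a nonsquare in `F`, and a quotient of two nonsquares is a square.
    obtain ⟨c, hc⟩ := not_forall.1 fun hc => hsq (isSquare_div_of_natCard_eq hp h₁ h₂ hc h)
    refine ⟨c, ?_, isSquare_div_of_not_isSquare hsq hc⟩
    rintro rfl
    exact hc (by rw [map_zero]; exact .zero)
  have hc0' : algebraMap (ZMod p) F c ≠ 0 := (map_ne_zero _).2 hc0
  refine ⟨s, ?_, c, hc0, ?_⟩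
  · rintro rfl
    rw [mul_zero] at hs
    exact div_ne_zero h0 hc0' hs
  · rw [pow_two, ← hs, div_mul_cancel₀ _ hc0']

end

end ArtinSchreierCurve

end

/-! ### The criterion over `K` and the isomorphism over `Kbar`. -/

theorem mainTheorem12 (p : ℕ) [Fact p.Prime] (hp : Odd p)
    (K : Type u) [Field K] [Finite K] [Algebra (ZMod p) K]
    (Kbar : Type u) [Field Kbar] [Algebra K Kbar] [IsAlgClosure K Kbar] :
    (∀ e₁ e₂ : K, e₁ ≠ 0 → e₂ ≠ 0 →
      (Nonempty (artinSchreierCurve p hp e₁ ≅ artinSchreierCurve p hp e₂) ↔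
        ∃ s : K, s ≠ 0 ∧ ∃ c : ZMod p, c ≠ 0 ∧ e₁ / e₂ = s ^ 2 * algebraMap (ZMod p) K c)) ∧
    (∀ e₁ e₂ : K, e₁ ≠ 0 → e₂ ≠ 0 →
      Nonempty (schemeBaseChange Kbar (artinSchreierCurve p hp e₁) ≅
        schemeBaseChange Kbar (artinSchreierCurve p hp e₂))) := by
  refine ⟨fun e₁ e₂ h₁ h₂ => ⟨?_, ?_⟩, fun e₁ e₂ h₁ h₂ => ?_⟩
  · rintro ⟨i⟩
    exact ArtinSchreierCurve.exists_of_natCard_eq hp h₁ h₂ (ArtinSchreierCurve.natCard_affineSolution_eq_of_iso hp h₁ h₂ i)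
  · rintro ⟨s, hs, c, hc, h⟩
    have hc' : algebraMap (ZMod p) K c ≠ 0 := (map_ne_zero _).2 hc
    -- The twist goes from `e₂` to `e₁`, so the relation needed is `e₂ * s ^ 2 = c⁻¹ * e₁`; hence
    -- the inverse.
    refine ArtinSchreierCurve.nonempty_iso_of_isTwist hp (a := Units.mk0 s hs) (c := (Units.mk0 _ hc')⁻¹) ⟨?_, ?_⟩
    · have h3 : e₁ = s ^ 2 * algebraMap (ZMod p) K c * e₂ := (div_eq_iff h₂).1 h
      rw [h3, Units.val_inv_eq_inv_val, Units.val_mk0, Units.val_mk0, Algebra.algebraMap_self,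
        RingHom.id_apply]
      field_simp
    · rw [Units.val_inv_eq_inv_val, Units.val_mk0, inv_pow, ← map_pow, ZMod.pow_card]
  · have : IsAlgClosed Kbar := IsAlgClosure.isAlgClosed K
    have twist : ∀ e : K, e ≠ 0 →
        Nonempty (schemeBaseChange Kbar (artinSchreierCurve p hp e) ≅
          artinSchreierCurve p hp (1 : Kbar)) := by
      intro e he
      have he' : algebraMap K Kbar e ≠ 0 := (map_ne_zero _).2 he
      -- With `r ^ 2 = e⁻¹`, scaling `X` alone brings the coefficient to `1`.
      obtain ⟨r, hr⟩ := IsAlgClosed.exists_pow_nat_eq (algebraMap K Kbar e)⁻¹ two_pos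
      have hr0 : r ≠ 0 := by
        rintro rfl
        rw [zero_pow two_ne_zero] at hr
        exact inv_ne_zero he' hr.symm
      refine ArtinSchreierCurve.nonempty_baseChange_iso_of_isTwist hp (a := Units.mk0 r hr0) (c := 1) ⟨?_, ?_⟩
      · rw [Units.val_mk0, hr, mul_inv_cancel₀ he', Units.val_one, one_mul]
      · rw [Units.val_one, one_pow]
    obtain ⟨i₁⟩ := twist e₁ h₁
    obtain ⟨i₂⟩ := twist e₂ h₂
    exact ⟨i₁ ≪≫ i₂.symm⟩
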